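/- Let $d\ge 1$, let $\mathcal A=\mathbb C^2$ and $\mathcal H=\mathcal K=\mathbb C^d$. For a unitary $U$ on $\mathcal H$ let $O_1^U$ be the quantum channel from operators on $\mathcal A$ to operators on $\mathcal A\otimes\mathcal H\otimes\mathcal K$ that maps the pure state $\alpha|0\rangle+\beta|1\rangle$ to $$\frac1{d^2}\Bigl(|\alpha|^2|0\rangle\langle0|\otimes I_{\mathcal H\otimes\mathcal K}+\alpha\bar\beta\,|0\rangle\langle1|\otimes U^\dagger\otimes I_{\mathcal K}+\bar\alpha\beta\,|1\rangle\langle0|\otimes U\otimes I_{\mathcal K}+|\beta|^2|1\rangle\langle1|\otimes I_{\mathcal H\otimes\mathcal K}\Bigr),$$ and let $O_2$ be the fully decohering channel that maps it to $$\frac1{d^2}\Bigl(|\alpha|^2|0\rangle\langle0|\otimes I_{\mathcal H\otimes\mathcal K}+|\beta|^2|1\rangle\langle1|\otimes I_{\mathcal H\otimes\mathcal K}\Bigr).$$ A verifier with an $m$-bit classical witness and $T$ oracle calls is, for each witness $w\in\{0,1\}^m$, a quantum algorithm that starts in a state of $\mathcal A\otimes\mathcal W$, where the workspace $\mathcal W$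 has arbitrary finite dimension, applies the oracle to $\mathcal A$ a total of $T$ times, applies after each call an arbitrary quantum channel that does not depend on the oracle and maps $(\mathcal A\otimes\mathcal H\otimes\mathcal K)\otimes\mathcal W$ to $\mathcal A\otimes\mathcal W$, and finally makes a two-outcome measurement (accept or reject). It is a QCMA protocol with completeness $a$ and soundness $b$, where $a>b$, if for every unitary $U$ there is a witness $w$ with which it accepts with probability at least $a$ when the oracle is $O_1^U$, and if with every witness $w$ it accepts with probability at most $b$ when the oracle is $O_2$. Theorem. There is a universal constant $c>0$ such that for all integers $d\ge1$, $m\ge0$, $T\ge0$ and all reals $a>b$, every QCMA protocol with an $m$-bit witness, $T$ oracle calls, completeness $a$ and soundness $b$ for this problem satisfies $$T\ \ge\ c\,(a-b)\,\sqrt{\frac{d}{m+1}}.$$ In particular, for constant $a>b$ (such as $a=2/3$, $b=1/3$), $\Omega\bigl(\sqrt{d/(m+1)}\bigr)$ oracle calls are needed. -/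

import Mathlib

open scoped Kronecker ComplexOrder

/-- Operators on the Hilbert space `ℂ^n` with orthonormal basis indexed by `n`. -/
abbrev Op (n : Type) : Type := Matrix n n ℂ

/-- `ampliate r Φ` is `Φ ⊗ id`, where `id` is the identity map on operators on `ℂ^r`:
the `(w, w')` block of the output is `Φ` applied to the `(w, w')` block of the input. -/
def ampliate {n k : Type} (r : Type) (Φ : Op n →ₗ[ℂ] Op k) : Op (n × r) →ₗ[ℂ] Op (k × r) where
  toFun X := Matrix.of fun p q => Φ (Matrix.of fun i j => X (i, p.2) (j, q.2)) p.1 q.1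
  map_add' X Y := by
    ext p q
    have h : (Matrix.of fun i j => (X + Y) (i, p.2) (j, q.2) : Op n)
        = (Matrix.of fun i j => X (i, p.2) (j, q.2))
          + (Matrix.of fun i j => Y (i, p.2) (j, q.2)) := rfl
    simp only [Matrix.of_apply, Matrix.add_apply]
    rw [← Matrix.add_apply, ← map_add]
    rfl
  map_smul' c X := by
    ext p q
    simp only [Matrix.of_apply, Matrix.smul_apply, RingHom.id_apply]
    rw [← Matrix.smul_apply, ← map_smul]
    rfl

/-- A quantum channel: a completely positive and trace preserving linear map. -/
structure IsChannel {n k : Type} [Fintype n] [Fintype k] (Φ : Op n →ₗ[ℂ] Op k) : Prop where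
  completelyPositive : ∀ (r : ℕ) (X : Op (n × Fin r)),
    X.PosSemidef → (ampliate (Fin r) Φ X).PosSemidef
  tracePreserving : ∀ X : Op n, (Φ X).trace = X.trace

/-- A density matrix (mixed state). -/
structure IsDensity {n : Type} [Fintype n] (ρ : Op n) : Prop where
  posSemidef : ρ.PosSemidef
  trace_eq_one : ρ.trace = 1

/-- The accepting element `E` of a two-outcome measurement `{E, 1 - E}`. -/
structure IsEffect {n : Type} [Fintype n] [DecidableEq n] (E : Op n) : Prop where
  posSemidef : E.PosSemidef
  le_one : (1 - E).PosSemidef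

/-- Basis labels of `A ⊗ H ⊗ K`, with `dim A = 2` and `dim H = dim K = d`. -/
abbrev OutIdx (d : ℕ) : Type := Fin 2 × (Fin d × Fin d)

/-- A superoperator from operators on `A` to operators on `A ⊗ H ⊗ K`. -/
abbrev Oracle (d : ℕ) : Type := Op (Fin 2) →ₗ[ℂ] Op (OutIdx d)

/-- The oracle with hidden unitary `U`:
`ρ ↦ d⁻² (ρ₀₀ |0⟩⟨0| ⊗ 1 ⊗ 1 + ρ₀₁ |0⟩⟨1| ⊗ U† ⊗ 1 + ρ₁₀ |1⟩⟨0| ⊗ U ⊗ 1 + ρ₁₁ |1⟩⟨1| ⊗ 1 ⊗ 1)`.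
On the pure state `α|0⟩ + β|1⟩` the coefficients `ρ₀₀, ρ₀₁, ρ₁₀, ρ₁₁` are
`|α|²`, `α * conj β`, `conj α * β`, `|β|²`. -/
noncomputable def hiddenUnitaryOracle (d : ℕ) (U : Op (Fin d)) : Oracle d where
  toFun ρ := ((d : ℂ) ^ 2)⁻¹ •
    (ρ 0 0 • (Matrix.single 0 0 1 ⊗ₖ ((1 : Op (Fin d)) ⊗ₖ (1 : Op (Fin d))))
      + ρ 0 1 • (Matrix.single 0 1 1 ⊗ₖ (U.conjTranspose ⊗ₖ (1 : Op (Fin d))))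
      + ρ 1 0 • (Matrix.single 1 0 1 ⊗ₖ (U ⊗ₖ (1 : Op (Fin d))))
      + ρ 1 1 • (Matrix.single 1 1 1 ⊗ₖ ((1 : Op (Fin d)) ⊗ₖ (1 : Op (Fin d)))))
  map_add' ρ τ := by
    simp only [Matrix.add_apply]
    module
  map_smul' c ρ := by
    simp only [Matrix.smul_apply, smul_eq_mul, RingHom.id_apply]
    module

/-- The fully decohering oracle:
`ρ ↦ d⁻² (ρ₀₀ |0⟩⟨0| ⊗ 1 ⊗ 1 + ρ₁₁ |1⟩⟨1| ⊗ 1 ⊗ 1)`. -/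
noncomputable def decoheringOracle (d : ℕ) : Oracle d where
  toFun ρ := ((d : ℂ) ^ 2)⁻¹ •
    (ρ 0 0 • (Matrix.single 0 0 1 ⊗ₖ ((1 : Op (Fin d)) ⊗ₖ (1 : Op (Fin d))))
      + ρ 1 1 • (Matrix.single 1 1 1 ⊗ₖ ((1 : Op (Fin d)) ⊗ₖ (1 : Op (Fin d)))))
  map_add' ρ τ := by
    simp only [Matrix.add_apply]
    module
  map_smul' c ρ := by
    simp only [Matrix.smul_apply, smul_eq_mul, RingHom.id_apply]
    module

/-- A quantum algorithm making `T` calls to an oracle. Its memory is `A ⊗ W` with `dim A = 2` and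
`W` of arbitrary finite dimension `workDim`. The `i`-th call applies the oracle to the register
`A`; afterwards an arbitrary channel, independent of the oracle, maps `(A ⊗ H ⊗ K) ⊗ W` back to
`A ⊗ W` (everything that is to be kept is stored in `W`). After the last call a two-outcome
measurement decides on acceptance. An algorithm that makes fewer calls, or decides adaptively
whether to make one, is covered by ignoring the outcome of a call. -/
structure QueryAlgorithm (d T : ℕ) where
  workDim : ℕ
  init : Op (Fin 2 × Fin workDim)
  init_isDensity : IsDensity init
  step : Fin T → (Op (OutIdx d × Fin workDim) →ₗ[ℂ] Op (Fin 2 × Fin workDim))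
  step_isChannel : ∀ i, IsChannel (step i)
  accept : Op (Fin 2 × Fin workDim)
  accept_isEffect : IsEffect accept

namespace QueryAlgorithm

/-- The state right before the final measurement, when the algorithm is run with oracle `O`. -/
def finalState {d T : ℕ} (M : QueryAlgorithm d T) (O : Oracle d) : Op (Fin 2 × Fin M.workDim) :=
  Fin.foldl T (fun ρ i => M.step i (ampliate (Fin M.workDim) O ρ)) M.init

/-- The probability that the algorithm accepts, when run with oracle `O`. -/
noncomputable def acceptProb {d T : ℕ} (M : QueryAlgorithm d T) (O : Oracle d) : ℝ :=
  (M.accept * M.finalState O).trace.re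

end QueryAlgorithm

/-- A verifier that receives an `m`-bit classical witness and makes `T` oracle calls. All its
operations may depend on the witness. No bound is put on its running time. -/
abbrev QCMAVerifier (d m T : ℕ) : Type := (Fin m → Bool) → QueryAlgorithm d T

/-- `V` is a QCMA protocol with completeness `a` and soundness `b` for deciding whether the oracle
hides a unitary (for every hidden unitary some witness is accepted with probability at least `a`)
or is fully decohering (every witness is accepted with probability at most `b`). -/
structure QCMAVerifier.IsProtocol {d m T : ℕ} (V : QCMAVerifier d m T) (a b : ℝ) : Prop where
  complete : ∀ U ∈ Matrix.unitaryGroup (Fin d) ℂ,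
    ∃ w, a ≤ (V w).acceptProb (hiddenUnitaryOracle d U)
  sound : ∀ w, (V w).acceptProb (decoheringOracle d) ≤ b

/-!
The lower bound already holds for the diagonal unitaries `signUnitary x` with signs given by a bit
string `x` of length `d`. For such a unitary the state handed out by the oracle on `H` is, up to
the control, a uniformly random basis vector: one call samples an index `i`, reveals it, and applies
the Pauli matrix `Z` to the query qubit if `x i` is set (`hiddenUnitaryOracle_signUnitary`). Since a
random `Z` dephases completely, the decohering oracle does the same with a fresh random bit at every
call (`decoheringOracle_eq`). The problem is thereby classical: to tell the bits of `x` at `T` random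
positions from `T` fresh random bits.

By pigeonhole one witness `w` is accepted with probability at least `a` for a set `S` of at least
`2 ^ (d - m)` strings (`QCMAVerifier.IsProtocol.exists_witness`). A uniform `x ∈ S` has entropy
deficiency at most `m` bits, so most of its coordinates are nearly unbiased: by the level-one
inequality `sum_sq_bias_le`, the squares of the biases add up to `O(m)`. Replacing one sampled bit
by a fresh one therefore changes the acceptance probability by `O(√(m / d))` on average, plus the
probability, at most `T / d`, that the index has occurred before. Fixing the sampled bit replaces `S`
by one of its halves, with one more coordinate fixed, and the expected deficiency does not grow
(`deficiency_insert_le`). Induction over the calls (`sum_hidden_le_fresh`) gives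
`a - b ≤ T² / d + O(T √((m + 1) / d))`, and since `a - b ≤ 1` this forces
`T √((m + 1) / d) ≥ (a - b) / 2`.
-/

/-! ### Bias of the coordinates of a large subset of the cube -/

/-- The sign `(-1)^s` of a bit. -/
def bitSign (s : Bool) : ℝ := if s then -1 else 1

/-- The subcube of the points that agree with `z` on the coordinates in `J`. -/
def subcube {d : ℕ} (J : Finset (Fin d)) (z : Fin d → Bool) : Finset (Fin d → Bool) :=
  Fintype.piFinset fun i => if i ∈ J then {z i} else Finset.univ

theorem mem_subcube {d : ℕ} {J : Finset (Fin d)} {z x : Fin d → Bool} :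
    x ∈ subcube J z ↔ ∀ i ∈ J, x i = z i := by
  simp only [subcube, Fintype.mem_piFinset]
  refine forall_congr' fun i => ?_
  split_ifs with h <;> simp [h]

/-- The entropy deficiency, in nats, of a uniform point of `S` relative to a uniform point of a
subcube with the coordinates in `J` fixed, multiplied by the cardinality of `S`. (With this factor
it is `0` for empty `S`, in spite of the value of `log 0`.) -/
noncomputable def deficiency {d : ℕ} (J : Finset (Fin d)) (S : Finset (Fin d → Bool)) : ℝ :=
  (S.card : ℝ) * (((d : ℝ) - (J.card : ℝ)) * Real.log 2 - Real.log (S.card : ℝ))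

theorem sum_subcube_exp_le {d : ℕ} (J : Finset (Fin d)) (z : Fin d → Bool) (l : Fin d → ℝ) :
    ∑ x ∈ subcube J z, Real.exp (∑ i ∈ Jᶜ, l i * bitSign (x i))
      ≤ Real.exp (((d : ℝ) - J.card) * Real.log 2 + ∑ i ∈ Jᶜ, l i ^ 2 / 2) := by
  have h1 : ∀ x ∈ subcube J z, Real.exp (∑ i ∈ Jᶜ, l i * bitSign (x i))
      = ∏ i, (if i ∈ J then 1 else Real.exp (l i * bitSign (x i))) := by
    intro x _
    rw [Real.exp_sum, ← Finset.prod_subset (Finset.subset_univ Jᶜ)]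
    · refine Finset.prod_congr rfl fun i hi => ?_
      rw [if_neg (Finset.mem_compl.mp hi)]
    · intro i _ hi
      rw [if_pos (by simpa using hi)]
  rw [Finset.sum_congr rfl h1, subcube,
    ← Finset.prod_univ_sum (fun i => if i ∈ J then {z i} else Finset.univ)
      (fun i s => if i ∈ J then (1 : ℝ) else Real.exp (l i * bitSign s))]
  have hcard : ((d : ℝ) - J.card) * Real.log 2 = ∑ i ∈ Jᶜ, Real.log 2 := by
    rw [Finset.sum_const, Finset.card_compl, Fintype.card_fin, nsmul_eq_mul,
      Nat.cast_sub (by simpa using Finset.card_le_univ J)]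
  rw [hcard, ← Finset.sum_add_distrib, Real.exp_sum, ← Finset.prod_compl_mul_prod J]
  have hJ : ∏ i ∈ J, ∑ s ∈ (if i ∈ J then {z i} else Finset.univ),
      (if i ∈ J then (1 : ℝ) else Real.exp (l i * bitSign s)) = 1 :=
    Finset.prod_eq_one fun i hi => by simp [hi]
  rw [hJ, mul_one]
  refine Finset.prod_le_prod (fun i _ => Finset.sum_nonneg fun s _ => ?_) fun i hi => ?_
  · split_ifs <;> positivity
  · have hi' : i ∉ J := Finset.mem_compl.mp hi
    have := Real.cosh_le_exp_half_sq (l i)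
    rw [Real.cosh_eq] at this
    simp only [hi', if_false, Fintype.sum_bool, bitSign, if_true, Bool.false_eq_true]
    rw [Real.exp_add, Real.exp_log two_pos, mul_one, mul_neg_one]
    linarith

/-- The level-one inequality: the exponential moment of `∑ i, l i * bitSign (x i)` over `S` is at
most the one over the subcube; take for `l i` the mean of `bitSign (x i)` and apply Jensen. -/
theorem sum_sq_bias_le {d : ℕ} {J : Finset (Fin d)} {z : Fin d → Bool}
    {S : Finset (Fin d → Bool)} (hS : S ⊆ subcube J z) :
    ∑ i ∈ Jᶜ, (∑ x ∈ S, bitSign (x i)) ^ 2 ≤ 2 * S.card * deficiency J S := by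
  rcases S.eq_empty_or_nonempty with rfl | hne
  · simp
  have hn : (0 : ℝ) < S.card := by exact_mod_cast hne.card_pos
  set l : Fin d → ℝ := fun i => (∑ x ∈ S, bitSign (x i)) / S.card with hl
  have hjensen := convexOn_exp.map_sum_le (t := S) (w := fun _ => (S.card : ℝ)⁻¹)
    (p := fun x => ∑ i ∈ Jᶜ, l i * bitSign (x i)) (fun _ _ => by positivity)
    (by simp [hn.ne']) (fun _ _ => Set.mem_univ _)
  have hmean : ∑ x ∈ S, (S.card : ℝ)⁻¹ • ∑ i ∈ Jᶜ, l i * bitSign (x i) = ∑ i ∈ Jᶜ, l i ^ 2 := by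
    rw [← Finset.smul_sum, Finset.sum_comm, Finset.smul_sum]
    refine Finset.sum_congr rfl fun i _ => ?_
    rw [← Finset.mul_sum, smul_eq_mul, hl]
    field_simp
  rw [hmean] at hjensen
  simp only [smul_eq_mul, ← Finset.mul_sum] at hjensen
  have hle := (Finset.sum_le_sum_of_subset_of_nonneg hS
    (fun x _ _ => (Real.exp_pos _).le)).trans (sum_subcube_exp_le J z l)
  have hexp : Real.exp (∑ i ∈ Jᶜ, l i ^ 2 + Real.log S.card)
      ≤ Real.exp (((d : ℝ) - J.card) * Real.log 2 + ∑ i ∈ Jᶜ, l i ^ 2 / 2) := by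
    rw [Real.exp_add, Real.exp_log hn]
    refine le_trans ?_ hle
    rwa [inv_mul_eq_div, le_div_iff₀ hn] at hjensen
  rw [Real.exp_le_exp, ← Finset.sum_div] at hexp
  have hsq : ∑ i ∈ Jᶜ, (∑ x ∈ S, bitSign (x i)) ^ 2 = (S.card : ℝ) ^ 2 * ∑ i ∈ Jᶜ, l i ^ 2 := by
    rw [Finset.mul_sum]
    refine Finset.sum_congr rfl fun i _ => ?_
    rw [hl]
    field_simp
  rw [hsq, deficiency]
  nlinarith [sq_nonneg (S.card : ℝ)]

theorem deficiency_nonneg {d : ℕ} {J : Finset (Fin d)} {z : Fin d → Bool}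
    {S : Finset (Fin d → Bool)} (hS : S ⊆ subcube J z) : 0 ≤ deficiency J S := by
  rcases S.eq_empty_or_nonempty with rfl | hne
  · simp [deficiency]
  have hn : (0 : ℝ) < S.card := by exact_mod_cast hne.card_pos
  have h := (Finset.sum_nonneg fun i _ => sq_nonneg _).trans (sum_sq_bias_le hS)
  exact nonneg_of_mul_nonneg_right h (by positivity)

/-- Revealing the bit at a fresh coordinate does not increase the expected deficiency. -/
theorem deficiency_insert_le {d : ℕ} {J : Finset (Fin d)} {i : Fin d} (hi : i ∉ J)
    (S : Finset (Fin d → Bool)) :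
    ∑ s, deficiency (insert i J) (S.filter fun x => x i = s) ≤ deficiency J S := by
  have hcard : ((S.filter fun x => x i = true).card : ℝ)
      + ((S.filter fun x => x i = false).card : ℝ) = S.card := by
    have := Finset.card_filter_add_card_filter_not (s := S) (fun x => x i = true)
    simp only [Bool.not_eq_true] at this
    exact_mod_cast this
  simp only [Fintype.sum_bool, deficiency, Finset.card_insert_of_notMem hi, ← hcard]
  set p : ℝ := ((S.filter fun x => x i = true).card : ℝ)
  set q : ℝ := ((S.filter fun x => x i = false).card : ℝ)
  have hp : 0 ≤ p := Nat.cast_nonneg _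
  have hq : 0 ≤ q := Nat.cast_nonneg _
  have hmid := Real.convexOn_mul_log.2 (Set.mem_Ici.mpr hp) (Set.mem_Ici.mpr hq)
    (by norm_num : (0 : ℝ) ≤ 1 / 2) (by norm_num : (0 : ℝ) ≤ 1 / 2) (by norm_num)
  simp only [smul_eq_mul] at hmid
  rcases eq_or_lt_of_le (add_nonneg hp hq) with h0 | h0
  · have hp0 : p = 0 := by linarith
    have hq0 : q = 0 := by linarith
    simp [hp0, hq0]
  · rw [show 1 / 2 * p + 1 / 2 * q = (p + q) / 2 by ring, Real.log_div h0.ne' two_ne_zero] at hmid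
    push_cast
    linarith

/-! ### Repeated sampling of the bits of a hidden string -/

section Sampling

variable {M : Type*} [AddCommGroup M] [Module ℝ M]

/-- The composition of `T` linear maps; the map with index `0` is applied first. -/
def composeAll : {T : ℕ} → (Fin T → M →ₗ[ℝ] M) → M →ₗ[ℝ] M
  | 0, _ => LinearMap.id
  | _ + 1, L => composeAll (fun t => L t.succ) ∘ₗ L 0

theorem foldl_eq_composeAll {T : ℕ} (L : Fin T → M →ₗ[ℝ] M) (v : M) :
    Fin.foldl T (fun v t => L t v) v = composeAll L v := by
  induction T generalizing v with
  | zero => simp [composeAll]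
  | succ T ih => rw [Fin.foldl_succ, ih (fun t => L t.succ)]; rfl

theorem composeAll_mem {D : Set M} {T : ℕ} {L : Fin T → M →ₗ[ℝ] M}
    (hL : ∀ t, ∀ v ∈ D, L t v ∈ D) {v : M} (hv : v ∈ D) : composeAll L v ∈ D := by
  induction T generalizing v with
  | zero => exact hv
  | succ T ih => exact ih (fun t => hL t.succ) (hL 0 v hv)

/-- Sample a uniform index `i` and apply the map selected by `i` and the bit `x i`. -/
noncomputable def hiddenMap {d : ℕ} (k : Fin d → Bool → M →ₗ[ℝ] M) (x : Fin d → Bool) :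
    M →ₗ[ℝ] M :=
  (d : ℝ)⁻¹ • ∑ i, k i (x i)

/-- Sample a uniform index `i` and apply the map selected by `i` and a fresh uniform bit. -/
noncomputable def freshMap {d : ℕ} (k : Fin d → Bool → M →ₗ[ℝ] M) : M →ₗ[ℝ] M :=
  (d : ℝ)⁻¹ • ∑ i, (2 : ℝ)⁻¹ • ∑ s, k i s

theorem inv_smul_sum_mem {D : Set M} (hD : Convex ℝ D) {ι : Type*} [Fintype ι] [Nonempty ι]
    {f : ι → M} (hf : ∀ i, f i ∈ D) : (Fintype.card ι : ℝ)⁻¹ • ∑ i, f i ∈ D := by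
  rw [Finset.smul_sum]
  refine hD.sum_mem (fun _ _ => by positivity) ?_ fun i _ => hf i
  simp

theorem hiddenMap_mem {D : Set M} (hD : Convex ℝ D) {d : ℕ} [NeZero d]
    {k : Fin d → Bool → M →ₗ[ℝ] M} (hk : ∀ i s, ∀ v ∈ D, k i s v ∈ D) (x : Fin d → Bool)
    {v : M} (hv : v ∈ D) : hiddenMap k x v ∈ D := by
  simpa [hiddenMap] using inv_smul_sum_mem hD fun i => hk i (x i) v hv

theorem freshMap_mem {D : Set M} (hD : Convex ℝ D) {d : ℕ} [NeZero d]
    {k : Fin d → Bool → M →ₗ[ℝ] M} (hk : ∀ i s, ∀ v ∈ D, k i s v ∈ D)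
    {v : M} (hv : v ∈ D) : freshMap k v ∈ D := by
  have h : ∀ i, (2 : ℝ)⁻¹ • ∑ s, k i s v ∈ D := fun i => by
    simpa using inv_smul_sum_mem hD fun s => hk i s v hv
  simpa [freshMap] using inv_smul_sum_mem hD h

/-- Splitting a sum over `S` by the first sampled index `i` and the bit found there. -/
theorem sum_hiddenMap {d : ℕ} (k : Fin d → Bool → M →ₗ[ℝ] M) (S : Finset (Fin d → Bool))
    (g : (Fin d → Bool) → M →ₗ[ℝ] ℝ) (v : M) :
    ∑ x ∈ S, g x (hiddenMap k x v)
      = (d : ℝ)⁻¹ * ∑ i, ∑ s, ∑ x ∈ S.filter (fun x => x i = s), g x (k i s v) := by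
  simp only [hiddenMap, LinearMap.smul_apply, LinearMap.sum_apply, map_smul, map_sum,
    smul_eq_mul, ← Finset.mul_sum]
  rw [Finset.sum_comm]
  congr 1
  refine Finset.sum_congr rfl fun i _ => ?_
  rw [← Finset.sum_fiberwise S (fun x => x i)]
  refine Finset.sum_congr rfl fun s _ => Finset.sum_congr rfl fun x hx => ?_
  rw [(Finset.mem_filter.mp hx).2]

/-- A test that samples the bits of a uniform `x ∈ S` at `T` uniform positions accepts with hardly
larger probability than when every sampled bit is fresh. By induction on `T`: a first index in `J`
has probability `#J / d` and is charged the trivial bound; for any other index `i`, replacing the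
bit `x i` by a fresh one costs half the bias of `x i`, and then `S` is split by that bit.
The inequality `|t| ≤ η / 2 + t ^ 2 / (2 * η)`, applied to the bias, makes the bound affine in the
deficiency, so that it passes through the average over the two halves of `S`. -/
theorem sum_hidden_le_fresh {D : Set M} (hD : Convex ℝ D) {e : M →ₗ[ℝ] ℝ}
    (he : ∀ v ∈ D, 0 ≤ e v ∧ e v ≤ 1) {d : ℕ} [NeZero d] {η : ℝ} (hη : 0 < η) {T : ℕ}
    {k : Fin T → Fin d → Bool → M →ₗ[ℝ] M} (hk : ∀ t i s, ∀ v ∈ D, k t i s v ∈ D)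
    {v : M} (hv : v ∈ D) {J : Finset (Fin d)} {z : Fin d → Bool} {S : Finset (Fin d → Bool)}
    (hS : S ⊆ subcube J z) :
    ∑ x ∈ S, e (composeAll (fun t => hiddenMap (k t) x) v)
      ≤ S.card * e (composeAll (fun t => freshMap (k t)) v)
        + S.card * (T * ((J.card + T) / d + η / 4)) + T / (2 * η * d) * deficiency J S := by
  induction T generalizing v J z S with
  | zero => simp [composeAll]
  | succ T ih =>
    have hd : (0 : ℝ) < d := by exact_mod_cast Nat.pos_of_ne_zero (NeZero.ne d)
    have hn : (0 : ℝ) ≤ S.card := Nat.cast_nonneg _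
    have hdef := deficiency_nonneg hS
    set F : M →ₗ[ℝ] ℝ := e ∘ₗ composeAll (fun t : Fin T => freshMap (k t.succ))
    have hF01 : ∀ w ∈ D, 0 ≤ F w ∧ F w ≤ 1 := fun w hw =>
      he _ (composeAll_mem (fun t w hw => freshMap_mem hD (hk t.succ) hw) hw)
    set G : (Fin d → Bool) → M →ₗ[ℝ] ℝ :=
      fun x => e ∘ₗ composeAll (fun t : Fin T => hiddenMap (k t.succ) x)
    have hG1 : ∀ x, ∀ w ∈ D, G x w ≤ 1 := fun x w hw =>
      (he _ (composeAll_mem (fun t w hw => hiddenMap_mem hD (hk t.succ) x hw) hw)).2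
    set B : ℝ := S.card * (T * ((J.card + 1 + T) / d + η / 4)) + T / (2 * η * d) * deficiency J S
      with hB
    have hB0 : 0 ≤ B := by positivity
    have hsplit : ∀ i, (((S.filter fun x => x i = true).card : ℝ)
        + ((S.filter fun x => x i = false).card : ℝ) = S.card) ∧
        ∑ x ∈ S, bitSign (x i) = ((S.filter fun x => x i = false).card : ℝ)
          - ((S.filter fun x => x i = true).card : ℝ) := by
      intro i
      constructor
      · have := Finset.card_filter_add_card_filter_not (s := S) (fun x => x i = true)
        simp only [Bool.not_eq_true] at this
        exact_mod_cast this
      · rw [← Finset.sum_fiberwise S (fun x => x i), Fintype.sum_bool]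
        have h1 : ∀ s : Bool, ∑ x ∈ S.filter (fun x => x i = s), bitSign (x i)
            = (S.filter fun x => x i = s).card * bitSign s := fun s => by
          rw [← nsmul_eq_mul, ← Finset.sum_const]
          exact Finset.sum_congr rfl fun x hx => by rw [(Finset.mem_filter.mp hx).2]
        rw [h1, h1]
        simp [bitSign]
        ring
    -- An index in `J` has been sampled before: the trivial bound `1` on the acceptance probability.
    have hrepeated : ∀ i ∈ J, ∑ s, ∑ x ∈ S.filter (fun x => x i = s), G x (k 0 i s v)
        ≤ S.card * (2⁻¹ * ∑ s, F (k 0 i s v)) + B + S.card := by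
      intro i _
      have h1 : ∀ s, ∑ x ∈ S.filter (fun x => x i = s), G x (k 0 i s v)
          ≤ (S.filter fun x => x i = s).card := fun s => by
        simpa using Finset.sum_le_card_nsmul (S.filter fun x => x i = s) _ 1
          fun x _ => hG1 x _ (hk 0 i s v hv)
      have h2 : 0 ≤ S.card * (2⁻¹ * ∑ s, F (k 0 i s v)) :=
        mul_nonneg hn (mul_nonneg (by norm_num)
          (Finset.sum_nonneg fun s _ => (hF01 _ (hk 0 i s v hv)).1))
      have h3 := h1 true
      have h4 := h1 false
      have h5 := (hsplit i).1
      rw [Fintype.sum_bool]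
      linarith
    -- A new index: exchange `x i` for a fresh bit, then apply the induction hypothesis to both halves.
    have hfresh : ∀ i ∈ Jᶜ, ∑ s, ∑ x ∈ S.filter (fun x => x i = s), G x (k 0 i s v)
        ≤ S.card * (2⁻¹ * ∑ s, F (k 0 i s v)) + B + |∑ x ∈ S, bitSign (x i)| / 2 := by
      intro i hi
      have hi' : i ∉ J := Finset.mem_compl.mp hi
      have h1 : ∀ s, ∑ x ∈ S.filter (fun x => x i = s), G x (k 0 i s v)
          ≤ (S.filter fun x => x i = s).card * F (k 0 i s v)
            + (S.filter fun x => x i = s).card * (T * ((J.card + 1 + T) / d + η / 4))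
            + T / (2 * η * d) * deficiency (insert i J) (S.filter fun x => x i = s) := by
        intro s
        have hsub : S.filter (fun x => x i = s) ⊆ subcube (insert i J) (Function.update z i s) := by
          intro x hx
          obtain ⟨hx, hxi⟩ := Finset.mem_filter.mp hx
          refine mem_subcube.mpr fun j hj => ?_
          rcases Finset.mem_insert.mp hj with rfl | hj
          · simpa using hxi
          · rw [Function.update_of_ne (ne_of_mem_of_not_mem hj hi')]
            exact mem_subcube.mp (hS hx) j hj
        have := ih (k := fun t => k t.succ) (fun t => hk t.succ) (hk 0 i s v hv) hsub
        rw [Finset.card_insert_of_notMem hi'] at this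
        push_cast at this
        exact this
      have h2 : T / (2 * η * d) * ∑ s, deficiency (insert i J) (S.filter fun x => x i = s)
          ≤ T / (2 * η * d) * deficiency J S :=
        mul_le_mul_of_nonneg_left (deficiency_insert_le hi' S) (by positivity)
      obtain ⟨h3, h4⟩ := hsplit i
      have h5 := h1 true
      have h6 := h1 false
      obtain ⟨h7, h8⟩ := hF01 _ (hk 0 i true v hv)
      obtain ⟨h9, h10⟩ := hF01 _ (hk 0 i false v hv)
      rw [Fintype.sum_bool] at h2 ⊢
      rw [Fintype.sum_bool, hB, h4, ← h3]
      set p : ℝ := ((S.filter fun x => x i = true).card : ℝ)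
      set q : ℝ := ((S.filter fun x => x i = false).card : ℝ)
      have h11 : (q - p) * (F (k 0 i false v) - F (k 0 i true v)) ≤ |q - p| := by
        refine (le_abs_self _).trans ?_
        rw [abs_mul]
        exact mul_le_of_le_one_right (abs_nonneg _) (abs_le.mpr ⟨by linarith, by linarith⟩)
      linarith
    have hbias : ∑ i ∈ Jᶜ, |∑ x ∈ S, bitSign (x i)| / 2
        ≤ d * (S.card * (η / 4)) + (2 * η)⁻¹ * deficiency J S := by
      rcases S.eq_empty_or_nonempty with rfl | hne
      · simp [deficiency]
      have hn' : (0 : ℝ) < S.card := by exact_mod_cast hne.card_pos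
      have h1 : ∀ i ∈ Jᶜ, |∑ x ∈ S, bitSign (x i)| / 2
          ≤ S.card * (η / 4) + (4 * η * S.card)⁻¹ * (∑ x ∈ S, bitSign (x i)) ^ 2 := by
        intro i _
        rw [← sq_abs (∑ x ∈ S, bitSign (x i))]
        set t := |∑ x ∈ S, bitSign (x i)|
        have : S.card * (η / 4) + (4 * η * S.card)⁻¹ * t ^ 2 - t / 2
            = (4 * η * S.card)⁻¹ * (S.card * η - t) ^ 2 := by
          field_simp
          ring
        have h0 : 0 ≤ (4 * η * S.card)⁻¹ * (S.card * η - t) ^ 2 := by positivity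
        linarith
      refine (Finset.sum_le_sum h1).trans ?_
      rw [Finset.sum_add_distrib, Finset.sum_const, ← Finset.mul_sum, nsmul_eq_mul]
      refine add_le_add (mul_le_mul_of_nonneg_right ?_ (by positivity)) ?_
      · exact_mod_cast (Finset.card_le_univ Jᶜ).trans_eq (Fintype.card_fin d)
      · refine (mul_le_mul_of_nonneg_left (sum_sq_bias_le hS) (by positivity)).trans_eq ?_
        field_simp
        ring
    have hfirst : F (freshMap (k 0) v) = (d : ℝ)⁻¹ * ∑ i, 2⁻¹ * ∑ s, F (k 0 i s v) := by
      simp [freshMap, mul_add]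
    have htotal : ∑ i, ∑ s, ∑ x ∈ S.filter (fun x => x i = s), G x (k 0 i s v)
        ≤ S.card * ∑ i, 2⁻¹ * ∑ s, F (k 0 i s v) + d * B + J.card * S.card
          + (d * (S.card * (η / 4)) + (2 * η)⁻¹ * deficiency J S) := by
      rw [← Finset.sum_add_sum_compl J (fun i =>
        ∑ s, ∑ x ∈ S.filter (fun x => x i = s), G x (k 0 i s v))]
      refine (add_le_add (Finset.sum_le_sum hrepeated) (Finset.sum_le_sum hfresh)).trans ?_
      simp only [Finset.sum_add_distrib]
      rw [← Finset.sum_add_sum_compl J (fun i => 2⁻¹ * ∑ s, F (k 0 i s v)), mul_add,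
        Finset.mul_sum, Finset.mul_sum]
      simp only [Finset.sum_const, nsmul_eq_mul]
      have hc : (J.card : ℝ) + (Jᶜ).card = d := by
        have := Finset.card_add_card_compl J
        rw [Fintype.card_fin] at this
        exact_mod_cast this
      rw [← hc] at hbias ⊢
      linarith
    calc ∑ x ∈ S, e (composeAll (fun t => hiddenMap (k t) x) v)
        = ∑ x ∈ S, G x (hiddenMap (k 0) x v) := rfl
      _ = (d : ℝ)⁻¹ * ∑ i, ∑ s, ∑ x ∈ S.filter (fun x => x i = s), G x (k 0 i s v) :=
          sum_hiddenMap _ _ _ _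
      _ ≤ (d : ℝ)⁻¹ * (S.card * ∑ i, 2⁻¹ * ∑ s, F (k 0 i s v) + d * B + J.card * S.card
          + (d * (S.card * (η / 4)) + (2 * η)⁻¹ * deficiency J S)) :=
          mul_le_mul_of_nonneg_left htotal (by positivity)
      _ = S.card * F (freshMap (k 0) v) + S.card * (T * ((J.card + 1 + T) / d + η / 4)
            + J.card / d + η / 4) + (T + 1) / (2 * η * d) * deficiency J S := by
          rw [hfirst, hB]
          field_simp
          ring
      _ ≤ _ := by
          have h1 : T * ((J.card + 1 + T) / d + η / 4) + J.card / d + η / 4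
              ≤ (T + 1) * ((J.card + (T + 1)) / d + η / 4) := by
            have : (0 : ℝ) ≤ (1 + T) / d := by positivity
            have h2 : (T + 1) * ((J.card + (T + 1)) / d + η / 4)
                - (T * ((J.card + 1 + T) / d + η / 4) + J.card / d + η / 4) = (1 + T) / d := by
              ring
            linarith
          have h2 := mul_le_mul_of_nonneg_left h1 hn
          push_cast
          have h3 : F (freshMap (k 0) v) = e (composeAll (fun t => freshMap (k t)) v) := rfl
          rw [h3]
          linarith

end Sampling

/-! ### The oracle of a diagonal unitary as a sampling process -/

/-- The diagonal of `Z ^ s` on the query qubit, where `Z` is the Pauli matrix `diag (1, -1)`. -/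
def phase (s : Bool) (a : Fin 2) : ℂ := if a = 0 then 1 else (bitSign s : ℂ)

/-- The diagonal unitary with the signs `bitSign (x i)`. -/
def signUnitary {d : ℕ} (x : Fin d → Bool) : Op (Fin d) :=
  Matrix.diagonal fun i => (bitSign (x i) : ℂ)

theorem bitSign_mul_self (s : Bool) : bitSign s * bitSign s = 1 := by
  cases s <;> simp [bitSign]

theorem phase_mul_self (s : Bool) (a : Fin 2) : phase s a * phase s a = 1 := by
  unfold phase
  split_ifs
  · simp
  · exact_mod_cast bitSign_mul_self s

theorem star_phase (s : Bool) (a : Fin 2) : star (phase s a) = phase s a := by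
  unfold phase
  split_ifs <;> simp

theorem signUnitary_mem {d : ℕ} (x : Fin d → Bool) :
    signUnitary x ∈ Matrix.unitaryGroup (Fin d) ℂ := by
  rw [Matrix.mem_unitaryGroup_iff, Matrix.star_eq_conjTranspose, signUnitary,
    Matrix.diagonal_conjTranspose, Matrix.diagonal_mul_diagonal, ← Matrix.diagonal_one]
  congr 1
  funext i
  simp only [Pi.star_apply, RCLike.star_def, Complex.conj_ofReal]
  exact_mod_cast bitSign_mul_self (x i)

/-- The channel that applies `Z ^ s` to the query qubit and prepares `|i⟩⟨i|` on `H` and the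
maximally mixed state on `K`. -/
noncomputable def phaseOracle (d : ℕ) (i : Fin d) (s : Bool) : Oracle d where
  toFun ρ := (d : ℂ)⁻¹ • ((Matrix.diagonal (phase s) * ρ * Matrix.diagonal (phase s))
    ⊗ₖ (Matrix.single i i 1 ⊗ₖ (1 : Op (Fin d))))
  map_add' ρ τ := by
    simp only [mul_add, add_mul, Matrix.add_kronecker, smul_add]
  map_smul' c ρ := by
    simp only [Matrix.mul_smul, Matrix.smul_mul, Matrix.smul_kronecker, RingHom.id_apply]
    rw [smul_comm]

theorem phaseOracle_apply {d : ℕ} (i : Fin d) (s : Bool) (ρ : Op (Fin 2)) (p q : OutIdx d) :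
    phaseOracle d i s ρ p q = (d : ℂ)⁻¹ * (phase s p.1 * ρ p.1 q.1 * phase s q.1
      * ((if i = p.2.1 ∧ i = q.2.1 then 1 else 0) * (if p.2.2 = q.2.2 then 1 else 0))) := by
  simp [phaseOracle, Matrix.kroneckerMap_apply, Matrix.single_apply, Matrix.one_apply]

theorem hiddenUnitaryOracle_signUnitary {d : ℕ} (x : Fin d → Bool) (ρ : Op (Fin 2)) :
    hiddenUnitaryOracle d (signUnitary x) ρ = (d : ℝ)⁻¹ • ∑ i, phaseOracle d i (x i) ρ := by
  ext ⟨a, h, k⟩ ⟨a', h', k'⟩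
  have hb := fun i => bitSign_mul_self (x i)
  simp only [hiddenUnitaryOracle, LinearMap.coe_mk, AddHom.coe_mk, Matrix.smul_apply,
    Matrix.sum_apply, phaseOracle_apply, Matrix.add_apply, Matrix.kroneckerMap_apply,
    Matrix.single_apply, Matrix.one_apply, signUnitary, Matrix.diagonal_conjTranspose,
    Matrix.diagonal_apply, Pi.star_apply, RCLike.star_def, Complex.conj_ofReal]
  by_cases hh : h = h'
  · subst hh
    rw [Finset.sum_eq_single h (fun i _ hi => by simp [hi]) (by simp)]
    have hb' : ((bitSign (x h) : ℂ)) * bitSign (x h) = 1 := by exact_mod_cast hb h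
    by_cases hk : k = k'
    · fin_cases a <;> fin_cases a' <;> simp [hk, phase]
      · ring
      · ring
      · ring
      linear_combination (-(d : ℂ)⁻¹ * (d : ℂ)⁻¹ * ρ 1 1) * hb'
    · simp [hk]
  · rw [Finset.sum_eq_zero]
    · simp [hh]
    · intro i _
      rw [if_neg (fun hi => hh (hi.1.symm.trans hi.2))]
      simp

theorem decoheringOracle_eq {d : ℕ} (ρ : Op (Fin 2)) :
    decoheringOracle d ρ = (d : ℝ)⁻¹ • ∑ i, (2 : ℝ)⁻¹ • ∑ s, phaseOracle d i s ρ := by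
  ext ⟨a, h, k⟩ ⟨a', h', k'⟩
  simp only [decoheringOracle, LinearMap.coe_mk, AddHom.coe_mk, Matrix.smul_apply,
    Matrix.sum_apply, phaseOracle_apply, Matrix.add_apply, Matrix.kroneckerMap_apply,
    Matrix.single_apply, Matrix.one_apply, Fintype.sum_bool]
  by_cases hh : h = h'
  · subst hh
    rw [Finset.sum_eq_single h (fun i _ hi => by simp [hi]) (by simp)]
    by_cases hk : k = k'
    · fin_cases a <;> fin_cases a' <;> simp [hk, phase, bitSign] <;> ring
    · simp [hk]
  · rw [Finset.sum_eq_zero]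
    · simp [hh]
    · intro i _
      rw [if_neg (fun hi => hh (hi.1.symm.trans hi.2))]
      simp

/-! ### Density matrices and effects -/

theorem ampliate_apply {n k r : Type} (Φ : Op n →ₗ[ℂ] Op k) (X : Op (n × r)) (p q : k × r) :
    ampliate r Φ X p q = Φ (Matrix.of fun i j => X (i, p.2) (j, q.2)) p.1 q.1 := rfl

theorem convex_isDensity {n : Type} [Fintype n] : Convex ℝ {ρ : Op n | IsDensity ρ} := by
  intro ρ hρ τ hτ a b ha hb hab
  refine ⟨?_, ?_⟩
  · have h : ∀ (c : ℝ) (σ : Op n), c • σ = (c : ℂ) • σ := fun c σ => by ext; simp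
    rw [h, h]
    exact (hρ.posSemidef.smul (by exact_mod_cast ha)).add (hτ.posSemidef.smul (by exact_mod_cast hb))
  · rw [Matrix.trace_add, Matrix.trace_smul, Matrix.trace_smul, hρ.trace_eq_one, hτ.trace_eq_one,
      ← add_smul, hab, one_smul]

open scoped MatrixOrder in
theorem trace_mul_re_nonneg {n : Type} [Fintype n] [DecidableEq n] {A B : Op n}
    (hA : A.PosSemidef) (hB : B.PosSemidef) : 0 ≤ (A * B).trace.re := by
  obtain ⟨C, rfl⟩ := CStarAlgebra.nonneg_iff_eq_star_mul_self.mp hB.nonneg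
  rw [Matrix.star_eq_conjTranspose, ← mul_assoc, Matrix.trace_mul_comm, ← mul_assoc]
  exact (Complex.le_def.mp (hA.mul_mul_conjTranspose_same C).trace_nonneg).1

/-- The acceptance probability `Re tr (E ρ)` as a function of the state. -/
noncomputable def acceptMap {n : Type} [Fintype n] (E : Op n) : Op n →ₗ[ℝ] ℝ :=
  Complex.reLm ∘ₗ (Matrix.traceLinearMap n ℂ ℂ ∘ₗ LinearMap.mulLeft ℂ E).restrictScalars ℝ

theorem acceptMap_apply {n : Type} [Fintype n] (E ρ : Op n) :
    acceptMap E ρ = (E * ρ).trace.re := rfl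

theorem acceptMap_mem {n : Type} [Fintype n] [DecidableEq n] {E ρ : Op n} (hE : IsEffect E)
    (hρ : IsDensity ρ) : 0 ≤ acceptMap E ρ ∧ acceptMap E ρ ≤ 1 := by
  refine ⟨trace_mul_re_nonneg hE.posSemidef hρ.posSemidef, ?_⟩
  have h := trace_mul_re_nonneg hE.le_one hρ.posSemidef
  rw [sub_mul, one_mul, Matrix.trace_sub, hρ.trace_eq_one, Complex.sub_re, Complex.one_re] at h
  rw [acceptMap_apply]
  linarith

theorem IsChannel.isDensity {n k : Type} [Fintype n] [Fintype k] {Φ : Op n →ₗ[ℂ] Op k}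
    (hΦ : IsChannel Φ) {ρ : Op n} (hρ : IsDensity ρ) : IsDensity (Φ ρ) := by
  refine ⟨?_, by rw [hΦ.tracePreserving, hρ.trace_eq_one]⟩
  exact (hΦ.completelyPositive 1 (ρ.submatrix Prod.fst Prod.fst)
    (hρ.posSemidef.submatrix _)).submatrix fun p => (p, 0)

/-- Positivity is visible in the Kraus decomposition of `phaseOracle`, with one Kraus operator for
each basis vector of `K`. -/
theorem isDensity_ampliate_phaseOracle {d W : ℕ} (i : Fin d) (s : Bool) {ρ : Op (Fin 2 × Fin W)}
    (hρ : IsDensity ρ) : IsDensity (ampliate (Fin W) (phaseOracle d i s) ρ) := by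
  constructor
  · let B : Fin d → Op (OutIdx d × Fin W) := fun k =>
      Matrix.diagonal fun p => if p.1.2 = (i, k) then phase s p.1.1 else 0
    have hB : ampliate (Fin W) (phaseOracle d i s) ρ = (d : ℂ)⁻¹ • ∑ k,
        B k * ρ.submatrix (fun p => (p.1.1, p.2)) (fun p => (p.1.1, p.2)) * (B k).conjTranspose := by
      ext ⟨⟨a, h, k⟩, w⟩ ⟨⟨a', h', k'⟩, w'⟩
      simp only [ampliate_apply, phaseOracle_apply, Matrix.of_apply, Matrix.smul_apply,
        Matrix.sum_apply, B, Matrix.diagonal_conjTranspose, Matrix.mul_diagonal,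
        Matrix.diagonal_mul, Matrix.submatrix_apply, Pi.star_apply, Prod.mk.injEq, smul_eq_mul]
      congr 1
      rw [Finset.sum_eq_single k (fun l _ hl => by simp [hl.symm]) (by simp), apply_ite star,
        star_phase, star_zero]
      simp only [eq_comm (a := i), eq_comm (a := k)]
      by_cases h1 : h = i <;> by_cases h2 : h' = i <;> by_cases h3 : k' = k <;>
        simp [h1, h2, h3]
    rw [hB]
    refine Matrix.PosSemidef.smul (Matrix.posSemidef_sum _ fun k _ =>
      (hρ.posSemidef.submatrix _).mul_mul_conjTranspose_same _) ?_
    simp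
  · have hd : (d : ℂ) ≠ 0 := by exact_mod_cast (Fin.pos i).ne'
    rw [← hρ.trace_eq_one]
    simp only [Matrix.trace, Matrix.diag_apply, ampliate_apply, phaseOracle_apply,
      Matrix.of_apply, Fintype.sum_prod_type, and_self, if_true, mul_one]
    refine Finset.sum_congr rfl fun a _ => ?_
    have h : ∀ (h : Fin d) (w : Fin W), (d : ℂ)⁻¹ * (phase s a * ρ (a, w) (a, w) * phase s a
        * (if i = h then 1 else 0)) = (d : ℂ)⁻¹ * (if i = h then ρ (a, w) (a, w) else 0) := by
      intro h w
      rw [mul_right_comm (phase s a), phase_mul_self, one_mul, mul_ite, mul_one, mul_zero]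
    simp only [h]
    rw [Finset.sum_comm, Finset.sum_congr rfl fun _ _ => Finset.sum_comm]
    simp [← Finset.mul_sum, mul_inv_cancel_left₀ hd]

/-! ### Query algorithms -/

namespace QueryAlgorithm

variable {d T : ℕ} (M : QueryAlgorithm d T)

/-- One query answered by `phaseOracle d i s`, followed by the `t`-th step of the algorithm. -/
noncomputable def phaseStep (t : Fin T) (i : Fin d) (s : Bool) :
    Op (Fin 2 × Fin M.workDim) →ₗ[ℝ] Op (Fin 2 × Fin M.workDim) :=
  (M.step t ∘ₗ ampliate (Fin M.workDim) (phaseOracle d i s)).restrictScalars ℝ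

theorem acceptProb_hiddenUnitaryOracle (x : Fin d → Bool) :
    M.acceptProb (hiddenUnitaryOracle d (signUnitary x))
      = acceptMap M.accept (composeAll (fun t => hiddenMap (M.phaseStep t) x) M.init) := by
  rw [← foldl_eq_composeAll, acceptMap_apply, acceptProb, finalState]
  congr! 6 with ρ t
  have h : ampliate (Fin M.workDim) (hiddenUnitaryOracle d (signUnitary x)) ρ
      = (d : ℝ)⁻¹ • ∑ i, ampliate (Fin M.workDim) (phaseOracle d i (x i)) ρ := by
    ext p q
    simp [ampliate_apply, hiddenUnitaryOracle_signUnitary, Matrix.sum_apply]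
  rw [h, LinearMap.map_smul_of_tower, map_sum]
  simp [hiddenMap, phaseStep]

theorem acceptProb_decoheringOracle :
    M.acceptProb (decoheringOracle d)
      = acceptMap M.accept (composeAll (fun t => freshMap (M.phaseStep t)) M.init) := by
  rw [← foldl_eq_composeAll, acceptMap_apply, acceptProb, finalState]
  congr! 6 with ρ t
  have h : ampliate (Fin M.workDim) (decoheringOracle d) ρ
      = (d : ℝ)⁻¹ • ∑ i, (2 : ℝ)⁻¹ • ∑ s, ampliate (Fin M.workDim) (phaseOracle d i s) ρ := by
    ext p q
    simp [ampliate_apply, decoheringOracle_eq, Matrix.sum_apply]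
  rw [h, LinearMap.map_smul_of_tower, map_sum]
  simp only [LinearMap.map_smul_of_tower, map_sum]
  simp [freshMap, phaseStep]

theorem phaseStep_isDensity (t : Fin T) (i : Fin d) (s : Bool) {ρ : Op (Fin 2 × Fin M.workDim)}
    (hρ : IsDensity ρ) : IsDensity (M.phaseStep t i s ρ) :=
  (M.step_isChannel t).isDensity (isDensity_ampliate_phaseOracle i s hρ)

/-- The average acceptance probability over the signs in `S` compared with the decohering
oracle. -/
theorem sum_acceptProb_le [NeZero d] {η : ℝ} (hη : 0 < η) (S : Finset (Fin d → Bool)) :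
    ∑ x ∈ S, M.acceptProb (hiddenUnitaryOracle d (signUnitary x))
      ≤ S.card * M.acceptProb (decoheringOracle d) + S.card * (T * (T / d + η / 4))
        + T / (2 * η * d) * (S.card * (d * Real.log 2 - Real.log S.card)) := by
  have h := sum_hidden_le_fresh (k := M.phaseStep) convex_isDensity
    (fun ρ hρ => acceptMap_mem M.accept_isEffect hρ) hη
    (fun t i s ρ hρ => M.phaseStep_isDensity t i s hρ) M.init_isDensity
    (J := ∅) (z := fun _ => false) (S := S) (fun x _ => mem_subcube.mpr (by simp))
  simpa [acceptProb_hiddenUnitaryOracle, acceptProb_decoheringOracle, deficiency] using h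

theorem acceptProb_decoheringOracle_nonneg [NeZero d] : 0 ≤ M.acceptProb (decoheringOracle d) := by
  rw [acceptProb_decoheringOracle]
  exact (acceptMap_mem M.accept_isEffect (composeAll_mem
    (D := {ρ | IsDensity ρ}) (fun t ρ hρ => freshMap_mem convex_isDensity
      (fun i s ρ hρ => M.phaseStep_isDensity t i s hρ) hρ) M.init_isDensity)).1

theorem acceptProb_hiddenUnitaryOracle_le_one [NeZero d] (x : Fin d → Bool) :
    M.acceptProb (hiddenUnitaryOracle d (signUnitary x)) ≤ 1 := by
  rw [acceptProb_hiddenUnitaryOracle]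
  exact (acceptMap_mem M.accept_isEffect (composeAll_mem
    (D := {ρ | IsDensity ρ}) (fun t ρ hρ => hiddenMap_mem convex_isDensity
      (fun i s ρ hρ => M.phaseStep_isDensity t i s hρ) x hρ) M.init_isDensity)).2

end QueryAlgorithm

/-! ### Verifiers with a classical witness -/

/-- By pigeonhole, some witness is accepted for a `2 ^ (-m)` fraction of all sign patterns. -/
theorem QCMAVerifier.IsProtocol.exists_witness {d m T : ℕ} {V : QCMAVerifier d m T} {a b : ℝ}
    (hV : V.IsProtocol a b) : ∃ (w : Fin m → Bool) (S : Finset (Fin d → Bool)),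
      S.Nonempty ∧ (d : ℝ) * Real.log 2 - Real.log S.card ≤ m * Real.log 2 ∧
      ∀ x ∈ S, a ≤ (V w).acceptProb (hiddenUnitaryOracle d (signUnitary x)) := by
  choose f hf using fun x : Fin d → Bool => hV.complete _ (signUnitary_mem x)
  obtain ⟨w, hw⟩ := Fintype.exists_le_card_fiber_of_nsmul_le_card f
    (b := (2 : ℝ) ^ d / 2 ^ m) (by simp [mul_div_cancel₀])
  have hpos : (0 : ℝ) < 2 ^ d / 2 ^ m := by positivity
  refine ⟨w, _, Finset.card_pos.mp (by exact_mod_cast hpos.trans_le hw), ?_, fun x hx => ?_⟩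
  · have h := Real.log_le_log hpos hw
    rw [Real.log_div (by positivity) (by positivity), Real.log_pow, Real.log_pow] at h
    linarith
  · rw [← (Finset.mem_filter.mp hx).2]
    exact hf x

theorem mainTheorem4 :
    ∃ c : ℝ, 0 < c ∧
      ∀ (d m T : ℕ), 1 ≤ d → ∀ (a b : ℝ), b < a →
        ∀ V : QCMAVerifier d m T, V.IsProtocol a b →
          c * (a - b) * Real.sqrt ((d : ℝ) / ((m : ℝ) + 1)) ≤ (T : ℝ) := by
  refine ⟨1 / 2, by norm_num, fun d m T hd a b hab V hV => ?_⟩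
  have : NeZero d := ⟨by omega⟩
  have hd0 : (0 : ℝ) < d := by exact_mod_cast hd
  have hm0 : (0 : ℝ) < (m : ℝ) + 1 := by positivity
  obtain ⟨w, S, hS, hlog, hacc⟩ := hV.exists_witness
  have hn : (0 : ℝ) < S.card := by exact_mod_cast hS.card_pos
  have hb := hV.sound w
  -- The acceptance probabilities lie in `[0, 1]`, so that the gap is at most one.
  have hgap : a - b ≤ 1 := by
    obtain ⟨x, hx⟩ := hS
    have h1 := (V w).acceptProb_hiddenUnitaryOracle_le_one x
    have h2 := (V w).acceptProb_decoheringOracle_nonneg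
    linarith [hacc x hx]
  -- `η` has the size of a typical bias, which balances the two terms that it enters.
  set η : ℝ := Real.sqrt (((m : ℝ) + 1) / d) with hηdef
  have hη : 0 < η := Real.sqrt_pos.mpr (by positivity)
  have hηsq : η ^ 2 * d = m + 1 := by
    rw [hηdef, Real.sq_sqrt (by positivity)]
    field_simp
  have hsqrt : Real.sqrt ((d : ℝ) / ((m : ℝ) + 1)) = η⁻¹ := by
    rw [hηdef, ← Real.sqrt_inv, inv_div]
  have hsum := (V w).sum_acceptProb_le hη S
  have hlow : S.card * a ≤ ∑ x ∈ S, (V w).acceptProb (hiddenUnitaryOracle d (signUnitary x)) := by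
    simpa using Finset.card_nsmul_le_sum S _ a hacc
  have hlog2 : Real.log 2 ≤ 1 := by linarith [Real.log_two_lt_d9]
  have hdef : T / (2 * η * d) * (S.card * (d * Real.log 2 - Real.log S.card))
      ≤ S.card * (T * η / 2) := by
    have h1 : S.card * (d * Real.log 2 - Real.log S.card) ≤ S.card * (η ^ 2 * d) := by
      refine mul_le_mul_of_nonneg_left (hlog.trans ?_) hn.le
      rw [hηsq]
      nlinarith [(Nat.cast_nonneg m : (0 : ℝ) ≤ m)]
    refine (mul_le_mul_of_nonneg_left h1 (by positivity)).trans_eq ?_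
    field_simp
  have hmain : a - b ≤ T * (T / d + η / 4) + T * η / 2 := by
    have h1 : (S.card : ℝ) * (V w).acceptProb (decoheringOracle d) ≤ S.card * b :=
      mul_le_mul_of_nonneg_left hb hn.le
    refine le_of_mul_le_mul_left ?_ hn
    linarith
  have hTd : T * ((T : ℝ) / d) ≤ (T * η) ^ 2 := by
    have h1 : (1 : ℝ) / d ≤ η ^ 2 := by
      rw [div_le_iff₀ hd0, hηsq]
      linarith [(Nat.cast_nonneg m : (0 : ℝ) ≤ m)]
    calc T * ((T : ℝ) / d) = (T : ℝ) ^ 2 * (1 / d) := by ring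
      _ ≤ (T : ℝ) ^ 2 * η ^ 2 := mul_le_mul_of_nonneg_left h1 (by positivity)
      _ = (T * η) ^ 2 := by ring
  rw [hsqrt, ← div_eq_mul_inv, div_le_iff₀ hη]
  -- With `ε = T * η` the bound reads `a - b ≤ ε ^ 2 + 3 / 4 * ε`, and `ε < (a - b) / 2 ≤ 1 / 2`.
  by_contra! hlt
  have h0 : 0 ≤ T * η := by positivity
  nlinarith
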